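/- Let $K$ be a field of characteristic $0$ and let $E=E_0\oplus E_1$ be the infinite-dimensional Grassmann algebra over $K$, where $E_0$ and $E_1$ are spanned by the monomials of even and of odd length. Let $A=UT_{1,1}(E)=\left\{\begin{pmatrix} a & c\\ 0 & b\end{pmatrix} : a,b\in E_0,\ c\in E_1\right\}$, with the $\mathbb{Z}_2$-grading in which $A_0$ consists of the diagonal matrices and $A_1$ of the matrices with $a=b=0$, and with the graded involution $\begin{pmatrix} a & c\\ 0 & b\end{pmatrix}^*=\begin{pmatrix} b & c\\ 0 & a\end{pmatrix}$. For $n_1,n_2,n_3,n_4\ge 0$ let $P_{n_1,n_2,n_3,n_4}$ be the space of multilinear polynomials, in the free associative algebra over $K$, in $n_1$ symmetric variables of degree $0$, $n_2$ symmetric variables of degree $1$, $n_3$ skew-symmetric variables of degree $0$ and $n_4$ skew-symmetric variables of degree $1$. Let $\mathrm{Id}(A)$ be the ideal of graded $*$-identities of $A$, i.e. of the polynomials that vanish whenever the variables are replaced by elements of $A$ that are homogeneous of the degree of the variable and are symmetric or skew-symmetric like the variable. The group $S_{n_1}\times S_{n_2}\times S_{n_3}\times S_{n_4}$ acts on $P_{n_1,n_2,n_3,n_4}(A)=P_{n_1,n_2,n_3,n_4}/(P_{n_1,n_2,n_3,n_4}\cap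 \mathrm{Id}(A))$ by permuting the variables of each kind; the character of this representation is the cocharacter $\chi_{n_1,n_2,n_3,n_4}(A)$. For $\lambda\vdash n$ let $\chi_\lambda$ be the irreducible character of $S_n$ attached to $\lambda$. **Theorem.** Let $n_1+n_2+n_3+n_4\ge 1$. Then $\chi_{n_1,n_2,n_3,n_4}(A)$ can be written in exactly one way as $$\chi_{n_1,n_2,n_3,n_4}(A)=\sum_{\langle\lambda\rangle} m_{\langle\lambda\rangle}\,\chi_{\lambda(1)}\otimes\chi_{\lambda(2)}\otimes\chi_{\lambda(3)}\otimes\chi_{\lambda(4)}$$ with non-negative integers $m_{\langle\lambda\rangle}$, where $\langle\lambda\rangle=(\lambda(1),\lambda(2),\lambda(3),\lambda(4))$ runs over the 4-tuples of partitions with $\lambda(i)\vdash n_i$, and the multiplicities are as follows, where $(0)$ stands for $\emptyset$: (i) if $\langle\lambda\rangle=((n_1),\emptyset,(n_3),\emptyset)$, so that $n_1+n_3\ge 1$, then $m_{\langle\lambda\rangle}=1$; (ii) if $\langle\lambda\rangle=((n_1),(1),(n_3),\emptyset)$, then $m_{\langle\lambda\rangle}=1$; (iii) in all remaining cases $m_{\langle\lambda\rangle}=0$.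 -/

import Mathlib

open Equiv (Perm)

noncomputable section

namespace UTCochar

/-! ### Graded algebras with graded involution, and their multilinear identities -/

/-- The four kinds of variables of the free graded algebra with graded involution: symmetric of
degree `0`, symmetric of degree `1`, skew-symmetric of degree `0`, skew-symmetric of degree `1`. -/
inductive VarKind
  | y0 | y1 | z0 | z1
  deriving DecidableEq

instance : Fintype VarKind :=
  ⟨{.y0, .y1, .z0, .z1}, fun k => by cases k <;> decide⟩

/-- The homogeneous degree of a kind of variables. -/
def VarKind.degree : VarKind → ZMod 2
  | y0 => 0
  | y1 => 1
  | z0 => 0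
  | z1 => 1

/-- `1` for symmetric and `-1` for skew-symmetric variables. -/
def VarKind.sign : VarKind → ℤ
  | y0 => 1
  | y1 => 1
  | z0 => -1
  | z1 => -1

/-- The countable set `Y ∪ Z` of variables: `(k, i)` is the `i`-th variable of kind `k`. -/
abbrev Var : Type := VarKind × ℕ

/-- A graded involution of a `ZMod 2`-graded algebra `A`: a linear map that reverses products, is
its own inverse and preserves the homogeneous components. -/
structure GradedInvolution {K A : Type*} [Field K] [Ring A] [Algebra K A]
    (𝒜 : ZMod 2 → Submodule K A) where
  toLin : A →ₗ[K] A
  map_mul_rev : ∀ a b, toLin (a * b) = toLin b * toLin a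
  involutive : ∀ a, toLin (toLin a) = a
  map_mem : ∀ i, ∀ a ∈ 𝒜 i, toLin a ∈ 𝒜 i

section Identities

variable (K : Type*) [Field K]

/-- The space `P_{n₁,n₂,n₃,n₄}` of multilinear polynomials: the span, in the free algebra on
`Y ∪ Z`, of the monomials in which the first `n k` variables of each kind `k` occur exactly once,
and no other variable occurs. -/
def multilinear (n : VarKind → ℕ) : Submodule K (FreeAlgebra K Var) :=
  Submodule.span K {f | ∃ l : List Var, l.Nodup ∧ (∀ v, v ∈ l ↔ v.2 < n v.1) ∧
    f = (l.map (FreeAlgebra.ι K)).prod}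

/-- The group `S_{n₁} × S_{n₂} × S_{n₃} × S_{n₄}`. -/
abbrev SymProd (n : VarKind → ℕ) : Type := ∀ k : VarKind, Perm (Fin (n k))

/-- The action of `S_{n₁} × S_{n₂} × S_{n₃} × S_{n₄}` on the variables: the component at `k`
permutes the first `n k` variables of kind `k`; all other variables are fixed. -/
def permVar {n : VarKind → ℕ} (w : SymProd n) (v : Var) : Var :=
  (v.1, (w v.1).extendDomain Fin.equivSubtype v.2)

theorem permVar_one {n : VarKind → ℕ} (v : Var) : permVar (1 : SymProd n) v = v := by
  simp [permVar]

theorem permVar_mul {n : VarKind → ℕ} (w w' : SymProd n) (v : Var) :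
    permVar (w * w') v = permVar w (permVar w' v) := by
  simp only [permVar, Pi.mul_apply, ← Equiv.Perm.extendDomain_mul]
  rfl

theorem permVar_lt {n : VarKind → ℕ} (w : SymProd n) (v : Var) :
    (permVar w v).2 < n (permVar w v).1 ↔ v.2 < n v.1 := by
  by_cases h : v.2 < n v.1
  · refine iff_of_true ?_ h
    have : permVar w v = (v.1, (w v.1 ⟨v.2, h⟩ : ℕ)) := by
      simp only [permVar]
      rw [Equiv.Perm.extendDomain_apply_subtype (w v.1) (f := Fin.equivSubtype) h]
      rfl
    rw [this]
    exact (w v.1 ⟨v.2, h⟩).2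
  · have : permVar w v = v := by
      simp only [permVar]
      rw [Equiv.Perm.extendDomain_apply_not_subtype (w v.1) (f := Fin.equivSubtype) h]
    rw [this]

/-- The induced action on polynomials, by substitution of variables:
`(w f)(x₁, x₂, …) = f(x_{w(1)}, x_{w(2)}, …)`. -/
def freeRep (n : VarKind → ℕ) : Representation K (SymProd n) (FreeAlgebra K Var) where
  toFun w := (FreeAlgebra.lift K (fun v => FreeAlgebra.ι K (permVar w v))).toLinearMap
  map_one' := by
    have : FreeAlgebra.lift K (fun v => FreeAlgebra.ι K (permVar (1 : SymProd n) v))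
        = AlgHom.id K (FreeAlgebra K Var) := by
      ext v
      simp [permVar_one]
    rw [this]
    rfl
  map_mul' w w' := by
    have : FreeAlgebra.lift K (fun v => FreeAlgebra.ι K (permVar (w * w') v))
        = (FreeAlgebra.lift K (fun v => FreeAlgebra.ι K (permVar w v))).comp
          (FreeAlgebra.lift K (fun v => FreeAlgebra.ι K (permVar w' v))) := by
      ext v
      simp [permVar_mul]
    rw [this]
    rfl

theorem freeRep_apply {n : VarKind → ℕ} (w : SymProd n) (f : FreeAlgebra K Var) :
    freeRep K n w f = FreeAlgebra.lift K (fun v => FreeAlgebra.ι K (permVar w v)) f := rfl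

theorem permVar_injective {n : VarKind → ℕ} (w : SymProd n) :
    Function.Injective (permVar w) := fun a b h => by
  rw [← permVar_one (n := n) a, ← permVar_one (n := n) b, ← inv_mul_cancel w, permVar_mul,
    permVar_mul, h]

theorem multilinear_le_comap (n : VarKind → ℕ) (w : SymProd n) :
    multilinear K n ≤ (multilinear K n).comap (freeRep K n w) := by
  refine Submodule.span_le.2 ?_
  rintro _ ⟨l, hl, hm, rfl⟩
  refine Submodule.subset_span ⟨l.map (permVar w), hl.map (permVar_injective w), ?_, ?_⟩
  · intro v
    have hv : permVar w (permVar w⁻¹ v) = v := by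
      rw [← permVar_mul, mul_inv_cancel, permVar_one]
    rw [← hv, List.mem_map_of_injective (permVar_injective w), hm]
    exact (permVar_lt w _).symm
  · rw [freeRep_apply, map_list_prod, List.map_map, List.map_map]
    congr 2
    ext v
    simp

variable {K} {A : Type*} [Ring A] [Algebra K A] (𝒜 : ZMod 2 → Submodule K A)
  (τ : GradedInvolution 𝒜)

/-- An admissible substitution: the value of each variable is homogeneous of the degree of the
variable, and symmetric or skew-symmetric like the variable. -/
def IsAdmissible (u : Var → A) : Prop :=
  ∀ v : Var, u v ∈ 𝒜 v.1.degree ∧ τ.toLin (u v) = v.1.sign • u v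

/-- The ideal of graded `*`-polynomial identities of `A`. -/
def identities : Submodule K (FreeAlgebra K Var) where
  carrier := {f | ∀ u : Var → A, IsAdmissible 𝒜 τ u → FreeAlgebra.lift K u f = 0}
  add_mem' hf hg u hu := by rw [map_add, hf u hu, hg u hu, add_zero]
  zero_mem' u _ := map_zero _
  smul_mem' c f hf u hu := by rw [map_smul, hf u hu, smul_zero]

theorem identities_le_comap (n : VarKind → ℕ) (w : SymProd n) :
    identities 𝒜 τ ≤ (identities 𝒜 τ).comap (freeRep K n w) := by
  intro f hf u hu
  have h := hf (fun v => u (permVar w v)) (fun v => hu (permVar w v))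
  rw [freeRep_apply, ← h, ← AlgHom.comp_apply]
  congr 1
  ext v
  simp

/-- The representation of `S_{n₁} × S_{n₂} × S_{n₃} × S_{n₄}` on `P_{n₁,n₂,n₃,n₄}`. -/
def multilinearRep (K : Type*) [Field K] (n : VarKind → ℕ) :
    Representation K (SymProd n) (multilinear K n) :=
  (freeRep K n).subrepresentation (multilinear K n) (multilinear_le_comap K n)

/-- The representation of `S_{n₁} × S_{n₂} × S_{n₃} × S_{n₄}` on
`P_{n₁,n₂,n₃,n₄}(A) = P_{n₁,n₂,n₃,n₄} / (P_{n₁,n₂,n₃,n₄} ∩ Id(A))`. -/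
def relMultilinearRep (n : VarKind → ℕ) : Representation K (SymProd n)
    (multilinear K n ⧸ (identities 𝒜 τ).comap (multilinear K n).subtype) :=
  (multilinearRep K n).quotient ((identities 𝒜 τ).comap (multilinear K n).subtype)
    (fun w _ hf => identities_le_comap 𝒜 τ n w hf)

/-- The `(n₁,n₂,n₃,n₄)`-th cocharacter of `A`. -/
def cocharacter [GradedAlgebra 𝒜] (n : VarKind → ℕ) : SymProd n → K :=
  (relMultilinearRep 𝒜 τ n).character

end Identities

/-! ### Irreducible characters of the symmetric groups -/

section Specht

/-- The Young diagram of a partition. -/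
def diagram {n : ℕ} (p : n.Partition) : YoungDiagram :=
  YoungDiagram.ofRowLens (p.parts.sort (· ≥ ·)) (p.parts.pairwise_sort (· ≥ ·)).sortedGE

theorem card_cellsOfRowLens (w : List ℕ) :
    (YoungDiagram.cellsOfRowLens w).card = w.sum := by
  induction w with
  | nil => rfl
  | cons a w ih =>
    rw [YoungDiagram.cellsOfRowLens, Finset.card_union_of_disjoint]
    · simp [ih]
    · rw [Finset.disjoint_left]
      rintro ⟨i, j⟩ h1 h2
      simp only [Finset.mem_product, Finset.mem_singleton, Finset.mem_map] at h1 h2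
      obtain ⟨⟨a, b⟩, -, h⟩ := h2
      exact absurd ((congrArg Prod.fst h).trans h1.1) (Nat.succ_ne_zero a)

theorem card_diagram {n : ℕ} (p : n.Partition) : (diagram p).cells.card = n := by
  change (YoungDiagram.cellsOfRowLens _).card = n
  rw [card_cellsOfRowLens, ← Multiset.sum_coe, Multiset.sort_eq, p.parts_sum]

/-- A Young tableau of shape `p`: a bijective filling of the diagram of `p` (all of them give
conjugate Young symmetrizers). -/
def tableau {n : ℕ} (p : n.Partition) : Fin n ≃ (diagram p).cells :=
  ((diagram p).cells.equivFinOfCardEq (card_diagram p)).symm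

/-- The permutations that preserve every row of the tableau. -/
def rowStabilizer {n : ℕ} (p : n.Partition) : Finset (Perm (Fin n)) :=
  {σ | ∀ i, (tableau p (σ i)).1.1 = (tableau p i).1.1}

/-- The permutations that preserve every column of the tableau. -/
def colStabilizer {n : ℕ} (p : n.Partition) : Finset (Perm (Fin n)) :=
  {σ | ∀ i, (tableau p (σ i)).1.2 = (tableau p i).1.2}

variable (K : Type*) [Field K]

/-- The Young symmetrizer: the row symmetrizer times the column antisymmetrizer. -/
def youngSymmetrizer {n : ℕ} (p : n.Partition) : MonoidAlgebra K (Perm (Fin n)) :=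
  (∑ σ ∈ rowStabilizer p, MonoidAlgebra.of K (Perm (Fin n)) σ) *
    ∑ σ ∈ colStabilizer p,
      (Equiv.Perm.sign σ : ℤ) • MonoidAlgebra.of K (Perm (Fin n)) σ

/-- The Specht module of `p`: the left ideal of `K[S_n]` generated by the Young symmetrizer. -/
def specht {n : ℕ} (p : n.Partition) : Ideal (MonoidAlgebra K (Perm (Fin n))) :=
  Ideal.span {youngSymmetrizer K p}

/-- The irreducible character `χ_p` of `S_n` attached to the partition `p` of `n`. -/
def irrChar {n : ℕ} (p : n.Partition) : Perm (Fin n) → K :=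
  (Representation.ofModule' (k := K) (G := Perm (Fin n)) (specht K p)).character

/-- The 4-tuples of partitions `⟨λ⟩ = (λ(1), λ(2), λ(3), λ(4))` with `λ(i) ⊢ n_i`. -/
abbrev MultiPartition (n : VarKind → ℕ) : Type := ∀ k : VarKind, (n k).Partition

/-- `m` is the family of multiplicities of the irreducible characters in `χ`:
`χ = ∑ m_⟨λ⟩ χ_{λ(1)} ⊗ χ_{λ(2)} ⊗ χ_{λ(3)} ⊗ χ_{λ(4)}`. -/
def IsMultiplicityFamily {n : VarKind → ℕ} (χ : SymProd n → K) (m : MultiPartition n → ℕ) :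
    Prop :=
  ∀ w : SymProd n, χ w = ∑ lam : MultiPartition n, (m lam : K) * ∏ k, irrChar K (lam k) (w k)

end Specht

/-! ### The algebra `UT_{1,1}(E)` and its involution -/

section UT

variable (K : Type*) [Field K]

/-- The infinite-dimensional Grassmann algebra on generators `e_0, e_1, …`. -/
abbrev Grassmann : Type _ := ExteriorAlgebra K (ℕ →₀ K)

/-- The components `E_0` and `E_1` spanned by the monomials of even and of odd length. -/
abbrev grassmannGrading : ZMod 2 → Submodule K (Grassmann K) :=
  CliffordAlgebra.evenOdd (0 : QuadraticForm K (ℕ →₀ K))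

theorem even_commute {x : Grassmann K} (hx : x ∈ grassmannGrading K 0) (y : Grassmann K) :
    Commute x y := by
  revert y
  induction x, hx using CliffordAlgebra.even_induction with
  | algebraMap r => exact fun y => Algebra.commutes r y
  | add x y hx hy ihx ihy => exact fun z => (ihx z).add_left (ihy z)
  | ι_mul_ι_mul m₁ m₂ x hx ih =>
    intro y
    refine Commute.mul_left ?_ (ih y)
    induction y using ExteriorAlgebra.induction with
    | algebraMap r => exact (Algebra.commutes r _).symm
    | ι m =>
      have h1 := ExteriorAlgebra.ι_add_mul_swap (R := K) m₁ m
      have h2 := ExteriorAlgebra.ι_add_mul_swap (R := K) m₂ m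
      change CliffordAlgebra.ι _ m₁ * CliffordAlgebra.ι _ m₂ * CliffordAlgebra.ι _ m =
        CliffordAlgebra.ι _ m * (CliffordAlgebra.ι _ m₁ * CliffordAlgebra.ι _ m₂)
      rw [mul_assoc, eq_neg_of_add_eq_zero_left h2, mul_neg, ← mul_assoc,
        eq_neg_of_add_eq_zero_left h1, neg_mul, neg_neg, mul_assoc]
    | mul a b ha hb => exact ha.mul_right hb
    | add a b ha hb => exact ha.add_right hb

theorem grassmann_mul_mem {i j k : ZMod 2} (h : i + j = k) {a b : Grassmann K}
    (ha : a ∈ grassmannGrading K i) (hb : b ∈ grassmannGrading K j) :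
    a * b ∈ grassmannGrading K k :=
  h ▸ SetLike.mul_mem_graded (A := grassmannGrading K) ha hb

/-- `UT_{1,1}(E)`: the matrices `(a c; 0 b)` with `a, b ∈ E_0` and `c ∈ E_1`. -/
def UT11 : Subalgebra K (Matrix (Fin 2) (Fin 2) (Grassmann K)) where
  carrier := {M | M 0 0 ∈ grassmannGrading K 0 ∧ M 0 1 ∈ grassmannGrading K 1 ∧ M 1 0 = 0 ∧
    M 1 1 ∈ grassmannGrading K 0}
  mul_mem' := by
    rintro M N ⟨h1, h2, h3, h4⟩ ⟨h1', h2', h3', h4'⟩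
    simp only [Set.mem_ofPred_eq, Matrix.mul_apply, Fin.sum_univ_two, h3, h3', mul_zero, zero_mul,
      add_zero, zero_add, true_and]
    exact ⟨grassmann_mul_mem K (by decide) h1 h1',
      add_mem (grassmann_mul_mem K (by decide) h1 h2') (grassmann_mul_mem K (by decide) h2 h4'),
      grassmann_mul_mem K (by decide) h4 h4'⟩
  add_mem' := by
    rintro M N ⟨h1, h2, h3, h4⟩ ⟨h1', h2', h3', h4'⟩
    exact ⟨add_mem h1 h1', add_mem h2 h2', by simp [h3, h3'], add_mem h4 h4'⟩
  algebraMap_mem' r := by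
    have h : algebraMap K (Grassmann K) r ∈ grassmannGrading K 0 :=
      SetLike.algebraMap_mem_graded (grassmannGrading K) r
    refine ⟨?_, ?_, ?_, ?_⟩ <;> simp [Matrix.algebraMap_matrix_apply, h]

/-- The canonical `ZMod 2`-grading of `UT_{1,1}(E)`: diagonal matrices in degree `0`, multiples of
the matrix unit `e_{12}` in degree `1`. -/
def utGrading (i : ZMod 2) : Submodule K (UT11 K) where
  carrier := {M | if i = 0 then M.1 0 1 = 0 else M.1 0 0 = 0 ∧ M.1 1 1 = 0}
  add_mem' := by
    intro M N hM hN
    by_cases h : i = 0 <;> simp_all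
  zero_mem' := by simp
  smul_mem' := by
    intro c M hM
    by_cases h : i = 0 <;> simp_all

theorem mem_utGrading_zero (M : UT11 K) : M ∈ utGrading K 0 ↔ M.1 0 1 = 0 :=
  Iff.rfl

theorem mem_utGrading_one (M : UT11 K) :
    M ∈ utGrading K 1 ↔ M.1 0 0 = 0 ∧ M.1 1 1 = 0 :=
  Iff.rfl

theorem ut_ext {M N : UT11 K} (h1 : M.1 0 0 = N.1 0 0) (h2 : M.1 0 1 = N.1 0 1)
    (h3 : M.1 1 1 = N.1 1 1) : M = N := by
  have h4 : M.1 1 0 = N.1 1 0 := M.2.2.2.1.trans N.2.2.2.1.symm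
  refine Subtype.ext (Matrix.ext fun i j => ?_)
  fin_cases i <;> fin_cases j <;> assumption

instance utGradedMonoid : SetLike.GradedMonoid (utGrading K) where
  one_mem := by simp [mem_utGrading_zero]
  mul_mem := by
    intro i j M N hM hN
    have hM' := M.2.2.2.1
    have hN' := N.2.2.2.1
    have hz : ∀ i : ZMod 2, i = 0 ∨ i = 1 := by decide
    obtain rfl | rfl : i = 0 ∨ i = 1 := hz i
    all_goals obtain rfl | rfl : j = 0 ∨ j = 1 := hz j
    all_goals
      first | rw [mem_utGrading_zero] at hM | rw [mem_utGrading_one] at hM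
      first | rw [mem_utGrading_zero] at hN | rw [mem_utGrading_one] at hN
    · rw [add_zero, mem_utGrading_zero]
      simp [Matrix.mul_apply, hM, hN]
    · rw [zero_add, mem_utGrading_one]
      simp [Matrix.mul_apply, hM, hN, hM']
    · rw [add_zero, mem_utGrading_one]
      simp [Matrix.mul_apply, hM, hN, hN']
    · rw [show (1 : ZMod 2) + 1 = 0 from rfl, mem_utGrading_zero]
      simp [Matrix.mul_apply, hM, hN]

theorem utGrading_isInternal : DirectSum.IsInternal (utGrading K) := by
  rw [DirectSum.isInternal_submodule_iff_isCompl (utGrading K) (i := 0) (j := 1) (by decide)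
    (by ext i; revert i; decide)]
  constructor
  · rw [Submodule.disjoint_def]
    intro M h0 h1
    rw [mem_utGrading_zero] at h0
    rw [mem_utGrading_one] at h1
    exact ut_ext K h1.1 h0 h1.2
  · rw [codisjoint_iff, eq_top_iff]
    intro M _
    rw [Submodule.mem_sup]
    refine ⟨⟨!![M.1 0 0, 0; 0, M.1 1 1], M.2.1, zero_mem _, rfl, M.2.2.2.2⟩, ?_,
      ⟨!![0, M.1 0 1; 0, 0], zero_mem _, M.2.2.1, rfl, zero_mem _⟩, ?_, ?_⟩
    · exact (mem_utGrading_zero K _).2 rfl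
    · exact (mem_utGrading_one K _).2 ⟨rfl, rfl⟩
    · exact ut_ext K (add_zero _) (zero_add _) (add_zero _)

instance utGradedAlgebra : GradedAlgebra (utGrading K) where
  toDecomposition := (utGrading_isInternal K).chooseDecomposition

/-- The involution `(a c; 0 b)^* = (b c; 0 a)` of `UT_{1,1}(E)`. -/
def utInvolution : GradedInvolution (utGrading K) where
  toLin :=
    { toFun := fun M => ⟨!![M.1 1 1, M.1 0 1; 0, M.1 0 0], M.2.2.2.2, M.2.2.1, rfl, M.2.1⟩
      map_add' := fun M N => ut_ext K rfl rfl rfl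
      map_smul' := fun c M => ut_ext K rfl rfl rfl }
  map_mul_rev M N := by
    have hM := M.2.2.2.1
    have hN := N.2.2.2.1
    refine ut_ext K ?_ ?_ ?_
    · simpa [Matrix.mul_apply, hM] using (even_commute K M.2.2.2.2 _).eq
    · simp [Matrix.mul_apply]
      rw [(even_commute K M.2.1 _).eq, (even_commute K N.2.2.2.2 _).eq, add_comm]
    · simpa [Matrix.mul_apply, hN] using (even_commute K M.2.1 _).eq
  involutive M := ut_ext K rfl rfl rfl
  map_mem i M hM := by
    change (if i = 0 then _ else _) at hM
    change (if i = 0 then _ else _)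
    by_cases h : i = 0
    · simpa [h] using hM
    · simpa [h, and_comm] using hM

end UT

end UTCochar

end

/-!
An admissible substitution in `UT_{1,1}(E)` gives a variable of kind `y0` a value `a · 1`, one of
kind `z0` a value `diag(a, -a)`, both with `a ∈ E_0`, one of kind `y1` a value `c e_{12}` with
`c ∈ E_1`, and one of kind `z1` the value `0`, since the involution fixes every matrix of degree `1`
(`entries_of_isAdmissible`). Two values of degree `1` have product `0`, so every multilinear
polynomial is an identity as soon as there is a variable of kind `z1` or there are two of kind `y1`;
then the cocharacter is `0`.

In the remaining cases any two values commute up to a sign that depends only on the kinds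
(`mul_swap`), so all multilinear monomials are proportional modulo the identities. The substitution
`testSubst` sends some monomial to a nonzero matrix, so the space of multilinear polynomials modulo
identities is one-dimensional and `testSubst` detects the identities in it. As `testSubst` depends
only on the kind of a variable, permutations of the variables within each kind act trivially: the
cocharacter is the constant `1` (`cocharacter_eq_one`).

The multiplicities are determined by positivity, without orthogonality of characters. Specht
modules are nonzero, so evaluating a decomposition at the identity shows that the zero character
has only zero multiplicities, and that a decomposition of the trivial character has exactly one
term, with multiplicity one and with one-dimensional factors, each of which is then a trivial
character (`isMultiplicityFamily_one_iff`). Finally `χ_λ` is trivial exactly for the one-row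
partition: the Young symmetrizer has coefficient `sign g` at each `g` in the column stabilizer,
which is incompatible with invariance if a column contains a transposition
(`irrChar_indiscrete`, `eq_indiscrete_of_irrChar_eq_one`).
-/

noncomputable section

namespace UTCochar

/-! ### One-dimensional Specht modules -/

section Specht

variable {K : Type*} [Field K] {n : ℕ} {p : n.Partition}

theorem mem_rowStabilizer {σ : Perm (Fin n)} :
    σ ∈ rowStabilizer p ↔ ∀ i, (tableau p (σ i)).1.1 = (tableau p i).1.1 := by
  simp [rowStabilizer]

theorem mem_colStabilizer {σ : Perm (Fin n)} :
    σ ∈ colStabilizer p ↔ ∀ i, (tableau p (σ i)).1.2 = (tableau p i).1.2 := by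
  simp [colStabilizer]

/-- A permutation that preserves all rows and all columns of a tableau is trivial. -/
theorem eq_one_of_mem_stabilizers {σ : Perm (Fin n)}
    (hr : σ ∈ rowStabilizer p) (hc : σ ∈ colStabilizer p) : σ = 1 := by
  rw [mem_rowStabilizer] at hr
  rw [mem_colStabilizer] at hc
  ext i : 1
  exact (tableau p).injective (Subtype.ext (Prod.ext (hr i) (hc i)))

theorem coeff_youngSymmetrizer (g : Perm (Fin n)) :
    (youngSymmetrizer K p).coeff g = ∑ σ ∈ rowStabilizer p, ∑ τ ∈ colStabilizer p,
      if σ * τ = g then ((Equiv.Perm.sign τ : ℤ) : K) else 0 := by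
  classical
  simp only [youngSymmetrizer, Finset.sum_mul, Finset.mul_sum, MonoidAlgebra.coeff_sum,
    Finsupp.finsetSum_apply, MonoidAlgebra.of_apply, mul_smul_comm,
    MonoidAlgebra.single_mul_single, mul_one]
  rw [Finset.sum_comm]
  refine Finset.sum_congr rfl fun σ _ => ?_
  rw [MonoidAlgebra.coeff_smul, MonoidAlgebra.coeff_sum, Finsupp.smul_apply,
    Finsupp.finsetSum_apply, Finset.smul_sum]
  refine Finset.sum_congr rfl fun τ _ => ?_
  rw [← Int.cast_smul_eq_zsmul K, MonoidAlgebra.coeff_single, Finsupp.single_apply]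
  simp

/-- On the column stabilizer the coefficients of the Young symmetrizer are the signs, because a
product of a row and a column permutation has only one such factorization. -/
theorem coeff_youngSymmetrizer_of_mem_colStabilizer {g : Perm (Fin n)}
    (hg : g ∈ colStabilizer p) :
    (youngSymmetrizer K p).coeff g = ((Equiv.Perm.sign g : ℤ) : K) := by
  have h1 : (1 : Perm (Fin n)) ∈ rowStabilizer p := mem_rowStabilizer.2 fun _ => rfl
  rw [coeff_youngSymmetrizer, Finset.sum_eq_single_of_mem 1 h1, Finset.sum_eq_single_of_mem g hg]
  · simp
  · intro τ _ hτ
    simp [hτ]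
  · intro σ hσ hσ1
    refine Finset.sum_eq_zero fun τ hτ => if_neg fun h => hσ1 ?_
    refine eq_one_of_mem_stabilizers hσ (mem_colStabilizer.2 fun i => ?_)
    rw [mem_colStabilizer] at hτ hg
    have := hg (τ⁻¹ i)
    have h' := hτ (τ⁻¹ i)
    rw [← h, Equiv.Perm.mul_apply] at this
    simp only [Equiv.Perm.coe_inv, Equiv.apply_symm_apply] at this h'
    rw [this, h']

theorem coeff_one_youngSymmetrizer : (youngSymmetrizer K p).coeff 1 = 1 := by
  have h : (1 : Perm (Fin n)) ∈ colStabilizer p := mem_colStabilizer.2 fun _ => rfl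
  simp [coeff_youngSymmetrizer_of_mem_colStabilizer h]

theorem youngSymmetrizer_mem_specht : youngSymmetrizer K p ∈ specht K p :=
  Ideal.mem_span_singleton_self _

instance finite_specht : Module.Finite K (specht K p) :=
  Module.Finite.of_injective ((specht K p).subtype.restrictScalars K) Subtype.val_injective

theorem finrank_specht_pos : 0 < Module.finrank K (specht K p) := by
  have : Nontrivial (specht K p) := by
    refine ⟨⟨⟨youngSymmetrizer K p, youngSymmetrizer_mem_specht⟩, 0, fun h => ?_⟩⟩
    have h0 : youngSymmetrizer K p = 0 := congrArg Subtype.val h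
    have h1 := coeff_one_youngSymmetrizer (K := K) (p := p)
    simp [h0] at h1
  exact Module.finrank_pos

theorem coe_ofModule'_specht (g : Perm (Fin n)) (x : specht K p) :
    ((Representation.ofModule' (k := K) (G := Perm (Fin n)) (specht K p) g x : specht K p) :
      MonoidAlgebra K (Perm (Fin n))) = MonoidAlgebra.single g 1 * x.1 := by
  simp [Representation.ofModule']

theorem irrChar_one : irrChar K p 1 = (Module.finrank K (specht K p) : K) :=
  Representation.char_one _

theorem mem_diagram {c : ℕ × ℕ} : c ∈ diagram p ↔ ∃ h : c.1 < (p.parts.sort (· ≥ ·)).length,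
    c.2 < (p.parts.sort (· ≥ ·))[c.1] :=
  YoungDiagram.mem_ofRowLens

/-- The indiscrete partition of `n`, which is empty for `n = 0`, is the only one whose diagram lies
in the first row. -/
theorem eq_indiscrete_iff : p = .indiscrete n ↔ ∀ i, (tableau p i).1.1 = 0 := by
  constructor
  · rintro rfl i
    have hn : n ≠ 0 := by rintro rfl; exact i.elim0
    obtain ⟨h, -⟩ := mem_diagram.1 (tableau (.indiscrete n) i).2
    simpa [Nat.Partition.indiscrete_parts hn] using h
  · intro h
    have hcard : p.parts.card ≤ 1 := by
      by_contra! hlt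
      have hl : 1 < (p.parts.sort (· ≥ ·)).length := by simpa using hlt
      have hmem : ((1, 0) : ℕ × ℕ) ∈ diagram p :=
        mem_diagram.2 ⟨hl, p.parts_pos ((Multiset.mem_sort _).1 (List.getElem_mem hl))⟩
      simpa using h ((tableau p).symm ⟨_, hmem⟩)
    rcases Nat.le_one_iff_eq_zero_or_eq_one.1 hcard with h0 | h1
    · have hn := p.parts_sum
      rw [Multiset.card_eq_zero.1 h0, Multiset.sum_zero] at hn
      subst hn
      exact Subsingleton.elim _ _
    · obtain ⟨a, ha⟩ := Multiset.card_eq_one.1 h1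
      have hn := p.parts_sum
      have ha0 : 0 < a := p.parts_pos (i := a) (by simp [ha])
      rw [ha, Multiset.sum_singleton] at hn
      subst hn
      exact Nat.Partition.ext (by rw [ha, Nat.Partition.indiscrete_parts ha0.ne'])

/-- The one-row partition has the trivial character: its Young symmetrizer is the sum of all
permutations. -/
theorem irrChar_indiscrete (g : Perm (Fin n)) : irrChar K (.indiscrete n) g = 1 := by
  set q : n.Partition := .indiscrete n with hq
  have hrow : rowStabilizer q = Finset.univ := Finset.eq_univ_of_forall fun σ =>
    mem_rowStabilizer.2 fun i => by rw [eq_indiscrete_iff.1 hq, eq_indiscrete_iff.1 hq]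
  have hinv : ∀ σ : Perm (Fin n),
      MonoidAlgebra.single σ (1 : K) * youngSymmetrizer K q = youngSymmetrizer K q := by
    intro σ
    have hsum : MonoidAlgebra.single σ (1 : K) * ∑ ρ, MonoidAlgebra.of K (Perm (Fin n)) ρ =
        ∑ ρ, MonoidAlgebra.of K (Perm (Fin n)) ρ := by
      rw [Finset.mul_sum]
      refine Fintype.sum_equiv (Equiv.mulLeft σ) _ _ fun ρ => ?_
      simp [MonoidAlgebra.single_mul_single]
    rw [youngSymmetrizer, hrow, ← mul_assoc, hsum]
  have hmul : ∀ a : MonoidAlgebra K (Perm (Fin n)),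
      ∃ c : K, a * youngSymmetrizer K q = c • youngSymmetrizer K q := by
    intro a
    induction a using MonoidAlgebra.induction_linear with
    | zero => exact ⟨0, by simp⟩
    | add a b ha hb =>
      obtain ⟨c, hc⟩ := ha
      obtain ⟨d, hd⟩ := hb
      exact ⟨c + d, by rw [add_mul, hc, hd, add_smul]⟩
    | single σ r =>
      refine ⟨r, ?_⟩
      have hr : MonoidAlgebra.single σ r = r • MonoidAlgebra.single σ (1 : K) := by simp
      rw [hr, smul_mul_assoc, hinv]
  have hmem : ∀ x : specht K q, ∃ c : K, x.1 = c • youngSymmetrizer K q := by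
    intro x
    obtain ⟨a, ha⟩ := Ideal.mem_span_singleton'.1 x.2
    rw [← ha]
    exact hmul a
  have hid : Representation.ofModule' (k := K) (G := Perm (Fin n)) (specht K q) g = 1 := by
    ext x : 2
    rw [coe_ofModule'_specht]
    obtain ⟨c, hc⟩ := hmem x
    rw [hc, mul_smul_comm, hinv, Module.End.one_apply, hc]
  have hrank : Module.finrank K (specht K q) = 1 := by
    refine le_antisymm (finrank_le_one ⟨_, youngSymmetrizer_mem_specht⟩ fun x => ?_)
      finrank_specht_pos
    obtain ⟨c, hc⟩ := hmem x
    exact ⟨c, Subtype.ext hc.symm⟩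
  rw [irrChar, Representation.character, hid, LinearMap.trace_one, hrank, Nat.cast_one]

/-- Only the one-row partition has the trivial character: if the action on the Specht module is
trivial then the coefficients of the Young symmetrizer are all equal, but a transposition inside a
column has coefficient `-1` and the identity has coefficient `1`. -/
theorem eq_indiscrete_of_irrChar_eq_one [CharZero K] (h : ∀ g, irrChar K p g = 1) :
    p = .indiscrete n := by
  rw [eq_indiscrete_iff]
  by_contra! hne
  obtain ⟨i, hi⟩ := hne
  have hrank : Module.finrank K (specht K p) = 1 := by
    exact_mod_cast irrChar_one.symm.trans (h 1)
  have hcell : ((0, (tableau p i).1.2) : ℕ × ℕ) ∈ diagram p :=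
    (diagram p).up_left_mem (Nat.zero_le _) le_rfl (tableau p i).2
  -- `j` is the entry at the top of the column of `i`.
  set j := (tableau p).symm ⟨_, hcell⟩ with hj
  have hjt : (tableau p j).1 = (0, (tableau p i).1.2) := by simp [hj]
  have hij : i ≠ j := by
    intro hij
    rw [← hij] at hjt
    exact hi (congrArg Prod.fst hjt)
  have hcol : Equiv.swap i j ∈ colStabilizer p := by
    refine mem_colStabilizer.2 fun x => ?_
    rcases eq_or_ne x i with rfl | hxi
    · rw [Equiv.swap_apply_left, hjt]
    rcases eq_or_ne x j with hxj | hxj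
    · rw [hxj, Equiv.swap_apply_right, hjt]
    · rw [Equiv.swap_apply_of_ne_of_ne hxi hxj]
  obtain ⟨c, hc, -⟩ := LinearMap.existsUnique_eq_smul_id_of_finrank_eq_one hrank
    (Representation.ofModule' (k := K) (G := Perm (Fin n)) (specht K p) (Equiv.swap i j))
  have htr := h (Equiv.swap i j)
  rw [irrChar, Representation.character, hc, map_smul, LinearMap.trace_id, hrank, Nat.cast_one,
    smul_eq_mul, mul_one] at htr
  rw [htr, one_smul] at hc
  have hfix := coe_ofModule'_specht (K := K) (p := p) (Equiv.swap i j)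
    ⟨_, youngSymmetrizer_mem_specht⟩
  rw [hc, LinearMap.id_apply] at hfix
  have hcoeff := congrArg (fun a => a.coeff (Equiv.swap i j)) hfix
  simp only [MonoidAlgebra.coeff_single_mul_apply, inv_mul_cancel, coeff_one_youngSymmetrizer,
    coeff_youngSymmetrizer_of_mem_colStabilizer hcol, Equiv.Perm.sign_swap hij] at hcoeff
  norm_num at hcoeff

end Specht

/-! ### Decompositions of the zero and of the trivial character -/

section Multiplicities

variable {K : Type*} [Field K] {n : VarKind → ℕ} {m : MultiPartition n → ℕ}

/-- The degree of the character attached to a 4-tuple of partitions. -/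
def tensorDim (K : Type*) [Field K] (lam : MultiPartition n) : ℕ :=
  ∏ k, Module.finrank K (specht K (lam k))

theorem tensorDim_pos (lam : MultiPartition n) : 0 < tensorDim K lam :=
  Finset.prod_pos fun _ _ => finrank_specht_pos

theorem IsMultiplicityFamily.apply_one {χ : SymProd n → K} (h : IsMultiplicityFamily K χ m) :
    χ 1 = ((∑ lam, m lam * tensorDim K lam : ℕ) : K) := by
  rw [h 1]
  simp [irrChar_one, tensorDim]

theorem isMultiplicityFamily_zero_iff [CharZero K] :
    IsMultiplicityFamily K (fun _ => 0) m ↔ ∀ lam, m lam = 0 := by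
  constructor
  · intro h lam
    have h1 := h.apply_one.symm
    rw [Nat.cast_eq_zero, Finset.sum_eq_zero_iff] at h1
    exact (Nat.mul_eq_zero.1 (h1 lam (Finset.mem_univ _))).resolve_right (tensorDim_pos lam).ne'
  · intro h w
    simp [h]

theorem isMultiplicityFamily_one_iff [CharZero K] : IsMultiplicityFamily K (fun _ => 1) m ↔
    ∀ lam, m lam = if lam = fun k => .indiscrete (n k) then 1 else 0 := by
  classical
  constructor
  · intro h
    have h1 : ∑ lam, m lam * tensorDim K lam = 1 := by exact_mod_cast h.apply_one.symm
    obtain ⟨mu, hmu, hother⟩ : ∃ mu, m mu * tensorDim K mu = 1 ∧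
        ∀ lam, lam ≠ mu → m lam = 0 := by
      obtain ⟨mu, -, hmu⟩ := Finset.exists_ne_zero_of_sum_ne_zero (h1.trans_ne one_ne_zero)
      have hsplit := Finset.add_sum_erase Finset.univ (fun lam => m lam * tensorDim K lam)
        (Finset.mem_univ mu)
      rw [h1] at hsplit
      have hzero : ∑ lam ∈ Finset.univ.erase mu, m lam * tensorDim K lam = 0 := by
        have := Nat.pos_of_ne_zero hmu
        omega
      refine ⟨mu, by simpa [hzero] using hsplit, fun lam hlam => ?_⟩
      have := Finset.sum_eq_zero_iff.1 hzero lam (by simp [hlam])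
      exact (Nat.mul_eq_zero.1 this).resolve_right (tensorDim_pos lam).ne'
    have hm := Nat.eq_one_of_mul_eq_one_right hmu
    have hdim := Nat.eq_one_of_mul_eq_one_left hmu
    have hd : ∀ k, irrChar K (mu k) 1 = 1 := by
      intro k
      rw [irrChar_one, Finset.prod_eq_one_iff.1 hdim k (Finset.mem_univ k), Nat.cast_one]
    have hmu1 : mu = fun k => .indiscrete (n k) := by
      funext k
      refine eq_indiscrete_of_irrChar_eq_one (K := K) fun g => ?_
      -- At the element with component `g` at `k` and `1` elsewhere, only the factor at `k` is left.
      have hw := h (Pi.mulSingle k g)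
      rw [Finset.sum_eq_single mu (fun lam _ hlam => by simp [hother lam hlam]) (by simp), hm,
        Nat.cast_one, one_mul, Finset.prod_eq_single k
          (fun l _ hl => by rw [Pi.mulSingle_eq_of_ne hl, hd]) (by simp)] at hw
      simpa using hw.symm
    intro lam
    rw [← hmu1]
    split_ifs with hlam
    · rw [hlam, hm]
    · exact hother lam hlam
  · intro h w
    simp [h, irrChar_indiscrete]

end Multiplicities

/-! ### Monomials evaluated on `UT_{1,1}(E)` -/

section Evaluation

variable {K : Type*} [Field K]

theorem eval_monomial {A : Type*} [Ring A] [Algebra K A] (u : Var → A) (l : List Var) :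
    FreeAlgebra.lift K u (l.map (FreeAlgebra.ι K)).prod = (l.map u).prod := by
  rw [map_list_prod, List.map_map]
  congr 2
  ext v
  simp

/-- The admissible values: `(a 0; 0 a)` with `a ∈ E_0` for `y0`, `(0 c; 0 0)` with `c ∈ E_1` for
`y1`, `(a 0; 0 -a)` with `a ∈ E_0` for `z0`, and only `0` for `z1`. -/
theorem entries_of_isAdmissible [CharZero K] {u : Var → UT11 K}
    (hu : IsAdmissible (utGrading K) (utInvolution K) u) (v : Var) :
    (v.1 = .y0 ∧ (u v).1 0 1 = 0 ∧ (u v).1 1 1 = (u v).1 0 0) ∨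
    (v.1 = .y1 ∧ (u v).1 0 0 = 0 ∧ (u v).1 1 1 = 0) ∨
    (v.1 = .z0 ∧ (u v).1 0 1 = 0 ∧ (u v).1 1 1 = -(u v).1 0 0) ∨
    (v.1 = .z1 ∧ u v = 0) := by
  obtain ⟨hdeg, hsign⟩ := hu v
  have h00 : (u v).1 1 1 = v.1.sign • (u v).1 0 0 :=
    congrArg (fun M : UT11 K => M.1 0 0) hsign
  have h01 : (u v).1 0 1 = v.1.sign • (u v).1 0 1 :=
    congrArg (fun M : UT11 K => M.1 0 1) hsign
  obtain ⟨k, i⟩ := v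
  cases k
  · exact .inl ⟨rfl, hdeg, by simpa [VarKind.sign] using h00⟩
  · exact .inr (.inl ⟨rfl, (mem_utGrading_one K _).1 hdeg⟩)
  · exact .inr (.inr (.inl ⟨rfl, hdeg, by simpa [VarKind.sign] using h00⟩))
  · obtain ⟨h1, h2⟩ := (mem_utGrading_one K _).1 hdeg
    have h3 : (u (.z1, i)).1 0 1 = -(u (.z1, i)).1 0 1 := by simpa [VarKind.sign] using h01
    refine .inr (.inr (.inr ⟨rfl, ut_ext K h1 ?_ h2⟩))
    have h4 : (2 : K) • (u (.z1, i)).1 0 1 = 0 := by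
      rw [two_smul]
      exact add_eq_zero_iff_eq_neg.2 h3
    exact (smul_eq_zero.1 h4).resolve_left two_ne_zero

/-- The sign that appears when two adjacent variables are interchanged. -/
def swapSign (K : Type*) [Field K] (v w : Var) : K :=
  if (v.1 = .y1 ∧ w.1 = .z0) ∨ (v.1 = .z0 ∧ w.1 = .y1) then -1 else 1

theorem mul_swap [CharZero K] {u : Var → UT11 K}
    (hu : IsAdmissible (utGrading K) (utInvolution K) u) (v w : Var) :
    u v * u w = swapSign K v w • (u w * u v) := by
  have hv0 := (u v).2.2.2.1
  have hw0 := (u w).2.2.2.1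
  have c1 := (even_commute K (u v).2.1 ((u w).1 0 0)).eq
  have c2 := (even_commute K (u v).2.1 ((u w).1 0 1)).eq
  have c3 := (even_commute K (u w).2.1 ((u v).1 0 1)).eq
  rcases entries_of_isAdmissible hu v with ⟨k, h1, h2⟩ | ⟨k, h1, h2⟩ | ⟨k, h1, h2⟩ | ⟨-, h1⟩ <;>
  rcases entries_of_isAdmissible hu w with
    ⟨k', h1', h2'⟩ | ⟨k', h1', h2'⟩ | ⟨k', h1', h2'⟩ | ⟨-, h1'⟩ <;>
  first
  | simp [h1']
  | simp [h1]
  | (refine ut_ext K ?_ ?_ ?_ <;>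
      simp [swapSign, k, k', Matrix.mul_apply, Fin.sum_univ_two, h1, h2, h1', h2', hv0, hw0, c1,
        c2, c3])

/-- Reordering the variables changes the value of a monomial by a factor that does not depend on
the substitution. -/
theorem exists_prod_eq_smul_of_perm [CharZero K] {l l' : List Var} (h : l.Perm l') :
    ∃ c : K, ∀ u : Var → UT11 K, IsAdmissible (utGrading K) (utInvolution K) u →
      (l.map u).prod = c • (l'.map u).prod := by
  induction h with
  | nil => exact ⟨1, fun u _ => by simp⟩
  | cons v _ ih =>
    obtain ⟨c, hc⟩ := ih
    exact ⟨c, fun u hu => by simp [hc u hu]⟩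
  | swap v w l =>
    refine ⟨swapSign K w v, fun u hu => ?_⟩
    rw [List.map_cons, List.map_cons, List.prod_cons, List.prod_cons, ← mul_assoc,
      mul_swap hu w v, List.map_cons, List.map_cons, List.prod_cons, List.prod_cons, ← mul_assoc,
      smul_mul_assoc]
  | trans _ _ ih1 ih2 =>
    obtain ⟨c, hc⟩ := ih1
    obtain ⟨d, hd⟩ := ih2
    exact ⟨c * d, fun u hu => by rw [hc u hu, hd u hu, smul_smul]⟩

theorem multilinear_le_identities_of_one_le_z1 [CharZero K] {n : VarKind → ℕ}
    (h : 1 ≤ n .z1) : multilinear K n ≤ identities (utGrading K) (utInvolution K) := by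
  refine Submodule.span_le.2 ?_
  rintro _ ⟨l, -, hl, rfl⟩ u hu
  have hmem : ((.z1, 0) : Var) ∈ l := (hl _).2 h
  have hzero : u (.z1, 0) = 0 := by
    simpa using entries_of_isAdmissible hu (.z1, 0)
  rw [eval_monomial]
  exact List.prod_eq_zero (List.mem_map.2 ⟨_, hmem, hzero⟩)

theorem mul_eq_zero_of_y1 [CharZero K] {u : Var → UT11 K}
    (hu : IsAdmissible (utGrading K) (utInvolution K) u) (i j : ℕ) :
    u (.y1, i) * u (.y1, j) = 0 := by
  have hi := entries_of_isAdmissible hu (.y1, i)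
  have hj := entries_of_isAdmissible hu (.y1, j)
  simp only [reduceCtorEq, false_and, true_and, or_false, false_or] at hi hj
  have hi0 := (u (.y1, i)).2.2.2.1
  have hj0 := (u (.y1, j)).2.2.2.1
  exact ut_ext K (by simp [Matrix.mul_apply, hi, hj0]) (by simp [Matrix.mul_apply, hi, hj])
    (by simp [Matrix.mul_apply, hi0, hj])

theorem multilinear_le_identities_of_two_le_y1 [CharZero K] {n : VarKind → ℕ}
    (h : 2 ≤ n .y1) : multilinear K n ≤ identities (utGrading K) (utInvolution K) := by
  refine Submodule.span_le.2 ?_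
  rintro _ ⟨l, -, hl, rfl⟩ u hu
  have hmem0 : ((.y1, 0) : Var) ∈ l := (hl _).2 (by simp only; omega)
  have hmem1 : ((.y1, 1) : Var) ∈ l.erase (.y1, 0) :=
    (List.mem_erase_of_ne (by simp)).2 ((hl _).2 (by simp only; omega))
  obtain ⟨c, hc⟩ := exists_prod_eq_smul_of_perm (K := K)
    ((List.perm_cons_erase hmem0).trans ((List.perm_cons_erase hmem1).cons _))
  rw [eval_monomial, hc u hu, List.map_cons, List.map_cons, List.prod_cons, List.prod_cons,
    ← mul_assoc, mul_eq_zero_of_y1 hu, zero_mul, smul_zero]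

/-- The substitution `y0 ↦ 1`, `y1 ↦ e_0 e_{12}`, `z0 ↦ diag(1, -1)`, `z1 ↦ 0`, in which `e_0` is
the first generator of the Grassmann algebra. -/
def testSubst (K : Type*) [Field K] : VarKind → UT11 K
  | .y0 => 1
  | .y1 => ⟨!![0, ExteriorAlgebra.ι K (Finsupp.single 0 1); 0, 0], zero_mem _,
      CliffordAlgebra.ι_mem_evenOdd_one _ _, rfl, zero_mem _⟩
  | .z0 => ⟨!![1, 0; 0, -1], SetLike.GradedOne.one_mem, zero_mem _, rfl,
      neg_mem SetLike.GradedOne.one_mem⟩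
  | .z1 => 0

theorem isAdmissible_testSubst :
    IsAdmissible (utGrading K) (utInvolution K) (fun v => testSubst K v.1) := by
  rintro ⟨k, i⟩
  cases k
  · exact ⟨SetLike.GradedOne.one_mem, ut_ext K (by simp [utInvolution, testSubst, VarKind.sign])
      (by simp [utInvolution, testSubst, VarKind.sign])
      (by simp [utInvolution, testSubst, VarKind.sign])⟩
  · exact ⟨(mem_utGrading_one K _).2 ⟨rfl, rfl⟩,
      ut_ext K (by simp [utInvolution, testSubst, VarKind.sign])
      (by simp [utInvolution, testSubst, VarKind.sign])
      (by simp [utInvolution, testSubst, VarKind.sign])⟩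
  · exact ⟨(mem_utGrading_zero K _).2 rfl,
      ut_ext K (by simp [utInvolution, testSubst, VarKind.sign])
      (by simp [utInvolution, testSubst, VarKind.sign])
      (by simp [utInvolution, testSubst, VarKind.sign])⟩
  · exact ⟨zero_mem _, by simp [testSubst]⟩

theorem isUnit_testSubst_z0 : IsUnit (testSubst K .z0) := by
  have hsq : testSubst K .z0 * testSubst K .z0 = 1 :=
    ut_ext K (by simp [testSubst, Matrix.mul_apply]) (by simp [testSubst, Matrix.mul_apply])
      (by simp [testSubst, Matrix.mul_apply])
  exact ⟨⟨_, _, hsq, hsq⟩, rfl⟩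

theorem testSubst_y1_ne_zero : testSubst K .y1 ≠ 0 := by
  intro h
  have h01 : ExteriorAlgebra.ι K (Finsupp.single 0 (1 : K)) = 0 :=
    congrArg (fun M : UT11 K => M.1 0 1) h
  rw [ExteriorAlgebra.ι_eq_zero_iff] at h01
  simp at h01

/-- If there is at most one odd variable and it is symmetric, then some multilinear monomial does
not vanish under `testSubst`. -/
theorem exists_monomial_ne_zero {n : VarKind → ℕ} (h1 : n .y1 ≤ 1) (h2 : n .z1 = 0) :
    ∃ l : List Var, l.Nodup ∧ (∀ v : Var, v ∈ l ↔ v.2 < n v.1) ∧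
      (l.map fun v => testSubst K v.1).prod ≠ 0 := by
  let L : VarKind → List Var := fun k => (List.range (n k)).map (Prod.mk k)
  have hL : ∀ k, (L k).Nodup := fun k =>
    List.nodup_range.map (Prod.mk_right_injective k)
  have hmem : ∀ k v, v ∈ L k ↔ v.1 = k ∧ v.2 < n v.1 := by
    rintro k ⟨k', i⟩
    simp only [L, List.mem_map, List.mem_range, Prod.mk.injEq]
    constructor
    · rintro ⟨j, hj, rfl, rfl⟩
      exact ⟨rfl, hj⟩
    · rintro ⟨rfl, hi⟩
      exact ⟨i, hi, rfl, rfl⟩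
  have hprod : ∀ k, ((L k).map fun v => testSubst K v.1).prod = testSubst K k ^ n k := by
    intro k
    simp [L, List.map_map, Function.comp_def]
  refine ⟨L .y0 ++ (L .z0 ++ L .y1), ?_, ?_, ?_⟩
  · have hdisj : ∀ k k', k ≠ k' → List.Disjoint (L k) (L k') := fun k k' hk v hv hv' =>
      hk (((hmem k v).1 hv).1.symm.trans ((hmem k' v).1 hv').1)
    refine (hL _).append ((hL _).append (hL _) (hdisj _ _ (by decide))) ?_
    exact List.disjoint_append_right.2 ⟨hdisj _ _ (by decide), hdisj _ _ (by decide)⟩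
  · rintro ⟨k, i⟩
    simp only [List.mem_append, hmem]
    cases k <;> simp [h2]
  · simp only [List.map_append, List.prod_append, hprod]
    have hy0 : testSubst K .y0 = 1 := rfl
    rw [hy0, one_pow, one_mul, Ne, (isUnit_testSubst_z0.pow _).mul_right_eq_zero]
    -- Up to a unit the monomial has the value `1` or that of the only odd variable.
    rcases Nat.le_one_iff_eq_zero_or_eq_one.1 h1 with h | h
    · rw [h, pow_zero]
      intro h10
      have h00 : (1 : Grassmann K) = 0 := congrArg (fun M : UT11 K => M.1 0 0) h10
      exact one_ne_zero h00
    · rw [h, pow_one]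
      exact testSubst_y1_ne_zero

end Evaluation

/-! ### The cocharacter -/

section Cocharacter

variable {K : Type*} [Field K] {n : VarKind → ℕ}

theorem cocharacter_eq_zero_of_le
    (h : multilinear K n ≤ identities (utGrading K) (utInvolution K)) :
    cocharacter (utGrading K) (utInvolution K) n = fun _ => 0 := by
  have htop : (identities (utGrading K) (utInvolution K)).comap (multilinear K n).subtype = ⊤ :=
    eq_top_iff.2 fun x _ => h x.2
  have hsub : Subsingleton
      (multilinear K n ⧸ (identities (utGrading K) (utInvolution K)).comap
        (multilinear K n).subtype) := Submodule.Quotient.subsingleton_iff.2 htop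
  funext w
  rw [cocharacter, Representation.character]
  exact (congrArg _ (Subsingleton.elim _ _)).trans (map_zero _)

/-- With at most one odd variable, which is symmetric, all multilinear monomials are proportional
modulo the identities, and one substitution detects the identities; that substitution depends only
on the kind of the variables, so permuting the variables changes nothing. -/
theorem cocharacter_eq_one [CharZero K] (h1 : n .y1 ≤ 1) (h2 : n .z1 = 0) :
    cocharacter (utGrading K) (utInvolution K) n = fun _ => 1 := by
  set I := identities (utGrading K) (utInvolution K) with hI
  obtain ⟨l, hl, hlm, hne⟩ := exists_monomial_ne_zero (K := K) h1 h2
  let ev := FreeAlgebra.lift K fun v : Var => testSubst K v.1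
  let f : FreeAlgebra K Var := (l.map (FreeAlgebra.ι K)).prod
  have hf : f ∈ multilinear K n := Submodule.subset_span ⟨l, hl, hlm, rfl⟩
  have hevf : ev f ≠ 0 := by
    rw [eval_monomial]
    exact hne
  -- The class of `f` spans the quotient.
  have hspan : ∀ g ∈ multilinear K n, ∃ c : K, g - c • f ∈ I := by
    intro g hg
    induction hg using Submodule.span_induction with
    | mem g hg =>
      obtain ⟨l', hl', hlm', rfl⟩ := hg
      obtain ⟨c, hc⟩ := exists_prod_eq_smul_of_perm (K := K)
        ((List.perm_ext_iff_of_nodup hl' hl).2 fun v => (hlm' v).trans (hlm v).symm)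
      refine ⟨c, fun u hu => ?_⟩
      rw [map_sub, map_smul, eval_monomial, eval_monomial, hc u hu, sub_self]
    | zero => exact ⟨0, by simp⟩
    | add g g' _ _ ihg ihg' =>
      obtain ⟨c, hc⟩ := ihg
      obtain ⟨d, hd⟩ := ihg'
      refine ⟨c + d, ?_⟩
      rw [add_smul, add_sub_add_comm]
      exact add_mem hc hd
    | smul a g _ ihg =>
      obtain ⟨c, hc⟩ := ihg
      refine ⟨a * c, ?_⟩
      rw [mul_smul, ← smul_sub]
      exact I.smul_mem a hc
  have hdetect : ∀ g ∈ multilinear K n, ev g = 0 → g ∈ I := by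
    intro g hg h0
    obtain ⟨c, hc⟩ := hspan g hg
    have hev : ev (g - c • f) = 0 := hc _ isAdmissible_testSubst
    rw [map_sub, h0, map_smul, zero_sub, neg_eq_zero, smul_eq_zero, or_iff_left hevf] at hev
    rwa [hev, zero_smul, sub_zero] at hc
  have hevw : ∀ (w : SymProd n) g, ev (freeRep K n w g) = ev g := by
    intro w g
    rw [freeRep_apply, ← AlgHom.comp_apply]
    congr 1
    ext v : 2
    simp [ev, permVar]
  have hid : ∀ w, relMultilinearRep (utGrading K) (utInvolution K) n w = 1 := by
    intro w
    refine LinearMap.ext fun x => ?_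
    obtain ⟨g, rfl⟩ := Submodule.Quotient.mk_surjective _ x
    refine (Submodule.Quotient.eq _).2 (hdetect _ (multilinearRep K n w g - g).2 ?_)
    change ev (freeRep K n w g - g) = 0
    rw [map_sub, hevw, sub_self]
  have hrank : Module.finrank K (multilinear K n ⧸ I.comap (multilinear K n).subtype) = 1 := by
    refine finrank_eq_one (Submodule.Quotient.mk ⟨f, hf⟩) ?_ fun x => ?_
    · rw [Ne, Submodule.Quotient.mk_eq_zero]
      exact fun h => hevf (h _ isAdmissible_testSubst)
    · obtain ⟨g, rfl⟩ := Submodule.Quotient.mk_surjective _ x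
      obtain ⟨c, hc⟩ := hspan g g.2
      exact ⟨c, ((Submodule.Quotient.eq (I.comap (multilinear K n).subtype)).2 hc).symm⟩
  have : Module.Finite K (multilinear K n ⧸ I.comap (multilinear K n).subtype) :=
    Module.finite_of_finrank_eq_succ hrank
  funext w
  rw [cocharacter, Representation.character, hid, LinearMap.trace_one, hrank, Nat.cast_one]

end Cocharacter

/-! ### Shapes of multiplicity one -/

section Shapes

variable {n : VarKind → ℕ}

theorem parts_eq_zero_iff {k : ℕ} (p : k.Partition) : p.parts = 0 ↔ k = 0 := by
  constructor
  · intro h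
    rw [← p.parts_sum, h, Multiset.sum_zero]
  · rintro rfl
    exact p.partition_zero_parts

theorem parts_eq_singleton_one_iff {k : ℕ} (p : k.Partition) : p.parts = {1} ↔ k = 1 := by
  constructor
  · intro h
    rw [← p.parts_sum, h, Multiset.sum_singleton]
  · rintro rfl
    exact p.partition_one_parts

theorem eq_indiscrete_of_le_one {k : ℕ} (hk : k ≤ 1) (p : k.Partition) : p = .indiscrete k := by
  have : Subsingleton k.Partition := by
    interval_cases k <;> infer_instance
  exact Subsingleton.elim _ _

/-- If there is at most one odd variable and it is symmetric, then a 4-tuple consists of one-row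
partitions as soon as its components at `y0` and `z0` do. -/
theorem eq_indiscrete_iff_of_le_one (h1 : n .y1 ≤ 1) (h2 : n .z1 = 0) (lam : MultiPartition n) :
    (lam = fun k => .indiscrete (n k)) ↔
      lam .y0 = .indiscrete (n .y0) ∧ lam .z0 = .indiscrete (n .z0) := by
  refine ⟨fun h => by simp [h], fun ⟨hy, hz⟩ => funext fun k => ?_⟩
  cases k
  · exact hy
  · exact eq_indiscrete_of_le_one h1 _
  · exact hz
  · exact eq_indiscrete_of_le_one (h2.trans_le zero_le_one) _

end Shapes

end UTCochar

end

/-! ### The multiplicities of the cocharacter -/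

open UTCochar in
theorem mainTheorem4 (K : Type*) [Field K] [CharZero K] (n : VarKind → ℕ)
    (hn : 1 ≤ ∑ k, n k) (m : MultiPartition n → ℕ) :
    IsMultiplicityFamily K (cocharacter (utGrading K) (utInvolution K) n) m ↔
      ∀ lam : MultiPartition n,
        (lam .y0 = .indiscrete (n .y0) ∧ (lam .y1).parts = 0 ∧
          lam .z0 = .indiscrete (n .z0) ∧ (lam .z1).parts = 0 → m lam = 1) ∧
        (lam .y0 = .indiscrete (n .y0) ∧ (lam .y1).parts = {1} ∧
          lam .z0 = .indiscrete (n .z0) ∧ (lam .z1).parts = 0 → m lam = 1) ∧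
        (¬ (lam .y0 = .indiscrete (n .y0) ∧ (lam .y1).parts = 0 ∧
            lam .z0 = .indiscrete (n .z0) ∧ (lam .z1).parts = 0) ∧
          ¬ (lam .y0 = .indiscrete (n .y0) ∧ (lam .y1).parts = {1} ∧
            lam .z0 = .indiscrete (n .z0) ∧ (lam .z1).parts = 0) → m lam = 0) := by
  simp only [parts_eq_zero_iff, parts_eq_singleton_one_iff]
  by_cases h : n .y1 ≤ 1 ∧ n .z1 = 0
  · obtain ⟨h1, h2⟩ := h
    rw [cocharacter_eq_one h1 h2, isMultiplicityFamily_one_iff]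
    refine forall_congr' fun lam => ?_
    have hor := Nat.le_one_iff_eq_zero_or_eq_one.1 h1
    simp only [eq_indiscrete_iff_of_le_one h1 h2 lam]
    split_ifs <;> grind
  · have hzero : cocharacter (utGrading K) (utInvolution K) n = fun _ => 0 := by
      rcases not_and_or.1 h with h1 | h2
      · exact cocharacter_eq_zero_of_le (multilinear_le_identities_of_two_le_y1 (by omega))
      · exact cocharacter_eq_zero_of_le (multilinear_le_identities_of_one_le_z1 (by omega))
    rw [hzero, isMultiplicityFamily_zero_iff]
    refine forall_congr' fun lam => ?_
    grind
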